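/- For a bounded convex set $B\subset\mathbb{R}^k$ ($k\ge 1$) with $0\in\operatorname{int}B$, define the self-volume $\omega^{(k)}_B$ recursively by $\omega^{(1)}_B=2$ and, for $k\ge 2$, $$\omega^{(k)}_B=\frac1k\int_{\partial B}\frac{\omega^{(k-1)}_{B\cap\nu_x^\perp}}{\mathcal H_{k-1}(B\cap\nu_x^\perp)}\,d\mathcal H_{k-1}(x),$$ where $\mathcal H_{k-1}$ is the $(k-1)$-dimensional Hausdorff measure, $\nu_x$ is the outer unit normal to $\partial B$ at $x$ (it exists and is unique for $\mathcal H_{k-1}$-almost every $x\in\partial B$), $\nu_x^\perp$ is the hyperplane through the origin orthogonal to $\nu_x$, and $B\cap\nu_x^\perp$ is regarded as a subset of the $(k-1)$-dimensional Euclidean space $\nu_x^\perp$. **Theorem.** Let $n,m\ge 1$, and let $A\subset\mathbb{R}^n$ and $B\subset\mathbb{R}^m$ be bounded convex sets with $0\in\operatorname{int}A$ and $0\in\operatorname{int}B$. Then $\omega^{(n)}_A$ and $\omega^{(m)}_B$ are finite, and the self-volume of the Cartesian product $A\times B\subset\mathbb{R}^{n+m}$ is $$\omega^{(n+m)}_{A\times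 B}=\omega^{(n)}_A\,\omega^{(m)}_B .$$ -/

import Mathlib

open MeasureTheory Set
open scoped ENNReal

universe u

/-- `u` is an outer unit normal at `x` to the set `B`: a unit vector such that `B` lies in the
half-space `{y | ⟪u, y⟫ ≤ ⟪u, x⟫}`. -/
def IsOuterUnitNormal {E : Type u} [NormedAddCommGroup E] [InnerProductSpace ℝ E]
    (B : Set E) (x u : E) : Prop :=
  ‖u‖ = 1 ∧ ∀ y ∈ B, inner ℝ u y ≤ inner ℝ u x

/-- The points of `∂B` at which "the" normal makes sense, that is, at which there is exactly one
outer unit normal. For a convex body of dimension `k` these are all points of `∂B` outside a set of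
`(k - 1)`-dimensional Hausdorff measure zero. -/
def essentialBoundary {E : Type u} [NormedAddCommGroup E] [InnerProductSpace ℝ E]
    (B : Set E) : Set E :=
  {x | x ∈ frontier B ∧ ∃! u, IsOuterUnitNormal B x u}

open Classical in
/-- The outer unit normal `ν_x` to `B` at a point `x` of the essential boundary (the value `0`
at points without any outer unit normal is never used). -/
noncomputable def outerUnitNormal {E : Type u} [NormedAddCommGroup E] [InnerProductSpace ℝ E]
    (B : Set E) (x : E) : E :=
  if h : ∃ u, IsOuterUnitNormal B x u then h.choose else 0

/-- The central section `B ∩ ν^⊥`, as a subset of the hyperplane `ν^⊥` (a Euclidean space in its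
own right). -/
def centralSection {E : Type u} [NormedAddCommGroup E] [InnerProductSpace ℝ E]
    (B : Set E) (ν : E) : Set ((Submodule.span ℝ {ν})ᗮ : Submodule ℝ E) :=
  {y | (y : E) ∈ B}

/-- The self-volume `ω^(k)_B` of a subset `B` of a `k`-dimensional Euclidean space `E`:
`ω^(1)_B = 2`, and for `k ≥ 2`
`ω^(k)_B = k⁻¹ ∫_{∂B} ω^(k-1)_{B ∩ ν_x^⊥} / ℋ_{k-1}(B ∩ ν_x^⊥) dℋ_{k-1}(x)`.
The integrand is nonnegative and the integral takes values in `[0, ∞]`. The iterated sections of a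
body in `ℝⁿ` by hyperplanes are its sections by the orthogonal complements of orthonormal frames.
The value in dimension `0` is a convention. -/
noncomputable def selfVolume : (k : ℕ) → {E : Type u} → [NormedAddCommGroup E] →
    [InnerProductSpace ℝ E] → [MeasurableSpace E] → [BorelSpace E] → Set E → ℝ≥0∞
  | 0, _, _, _, _, _, _ => 1
  | 1, _, _, _, _, _, _ => 2
  | k + 2, _, _, _, _, _, B =>
      ((k + 2 : ℕ) : ℝ≥0∞)⁻¹ *
        ∫⁻ x in essentialBoundary B,
          selfVolume (k + 1) (centralSection B (outerUnitNormal B x)) /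
            (μHE[k + 1] : Measure _) (centralSection B (outerUnitNormal B x)) ∂μHE[k + 1]

/-- The Cartesian product `A × B ⊆ ℝⁿ⁺ᵐ` of `A ⊆ ℝⁿ` and `B ⊆ ℝᵐ`: the vectors whose first `n`
coordinates form a point of `A` and whose last `m` coordinates form a point of `B`. -/
def euclideanProd {n m : ℕ} (A : Set (EuclideanSpace ℝ (Fin n)))
    (B : Set (EuclideanSpace ℝ (Fin m))) : Set (EuclideanSpace ℝ (Fin (n + m))) :=
  {z | WithLp.toLp 2 (fun i => z (Fin.castAdd m i)) ∈ A ∧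
    WithLp.toLp 2 (fun j => z (Fin.natAdd n j)) ∈ B}

/-! The essential boundary of `A × B` splits into `∂A × int B` and `int A × ∂B`, both restricted to
points with a unique normal. Corners drop out without any null-set argument: they carry the two
distinct normals `(a, 0)` and `(0, b)`.

Over `∂A × int B` the normal at `(x, y)` is `(ν_x, 0)`, and the central section is `(A ∩ ν_x^⊥) ×
B`. By induction on `n + m` the integrand is the density of `A` at `x` times the constant `ω_B /
|B|`. Integrating over `y` gives back `|B|`, and the recursion for `A` gives `n ω_A`, so this half
contributes `n ω_A ω_B`. The other half contributes `m ω_A ω_B`, and the factor `1 / (n + m)`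
cancels the sum.

The analytic point is that Hausdorff measure on `∂A × W` is the product measure, which fails for
general sets. Here `∂A` is cut into pieces with almost constant normal, each nearly isometric to its
projection to a hyperplane (`euclideanHausdorffMeasure_almost_flat`), and the distortion tends to 1.
The recursion extends to dimension one when `ω^(0) = 1`, so the induction starts at `n = m = 0`.
Stating it for abstract orthogonal splittings lets it apply directly to hyperplanes. -/

section Normals

/-! ### Outer normals and measurability of the essential boundary -/

variable {E : Type*} [NormedAddCommGroup E] [InnerProductSpace ℝ E]

theorem IsOuterUnitNormal.inner_le_of_mem_closure {B : Set E} {x u y : E}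
    (h : IsOuterUnitNormal B x u) (hy : y ∈ closure B) : inner ℝ u y ≤ inner ℝ u x := by
  have hc : IsClosed {y : E | inner ℝ u y ≤ inner ℝ u x} :=
    isClosed_le (by fun_prop) continuous_const
  exact closure_minimal h.2 hc hy

theorem outerUnitNormal_spec {B : Set E} {x : E} (hx : x ∈ essentialBoundary B) :
    IsOuterUnitNormal B x (outerUnitNormal B x) := by
  have h : ∃ u, IsOuterUnitNormal B x u := hx.2.exists
  rw [outerUnitNormal, dif_pos h]
  exact h.choose_spec

theorem eq_outerUnitNormal {B : Set E} {x u : E} (hx : x ∈ essentialBoundary B)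
    (hu : IsOuterUnitNormal B x u) : u = outerUnitNormal B x :=
  hx.2.unique hu (outerUnitNormal_spec hx)

/-- A small step from `x` in direction `w` stays in `B` and would increase the functional if `w ≠
0`. -/
theorem eq_zero_of_forall_inner_le {B : Set E} {x w : E} (hx : x ∈ interior B)
    (h : ∀ y ∈ B, inner ℝ w y ≤ inner ℝ w x) : w = 0 := by
  have hlim : Filter.Tendsto (fun t : ℝ => x + t • w) (nhds 0) (nhds x) := by
    have : Continuous (fun t : ℝ => x + t • w) := by fun_prop
    simpa using this.tendsto 0
  have hev := hlim.eventually (mem_interior_iff_mem_nhds.1 hx)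
  have hev' : ∀ᶠ t in nhdsWithin (0 : ℝ) (Ioi 0), x + t • w ∈ B :=
    hev.filter_mono nhdsWithin_le_nhds
  obtain ⟨t, ht, ht0⟩ := (hev'.and self_mem_nhdsWithin).exists
  have h1 := h _ ht
  rw [inner_add_right, real_inner_smul_right, real_inner_self_eq_norm_sq] at h1
  have ht0 : 0 < t := ht0
  have h2 : ‖w‖ ^ 2 ≤ 0 := by
    by_contra hc
    have := mul_pos ht0 (not_le.1 hc)
    linarith
  simpa using le_antisymm h2 (sq_nonneg _)

/-- A boundary point of a convex body has an outer unit normal. -/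
theorem exists_isOuterUnitNormal [CompleteSpace E] {B : Set E} (hB : Convex ℝ B)
    (hne : (interior B).Nonempty) {x : E} (hx : x ∉ interior B) :
    ∃ u, IsOuterUnitNormal B x u := by
  obtain ⟨f, hf⟩ := geometric_hahn_banach_open_point hB.interior isOpen_interior hx
  obtain ⟨w, rfl⟩ := (InnerProductSpace.toDual ℝ E).surjective f
  simp only [InnerProductSpace.toDual_apply_apply] at hf
  have hw : w ≠ 0 := by
    rintro rfl
    obtain ⟨a, ha⟩ := hne
    simpa using hf a ha
  have hpos : 0 < ‖w‖ := norm_pos_iff.2 hw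
  refine ⟨‖w‖⁻¹ • w, by rw [norm_smul, norm_inv, norm_norm, inv_mul_cancel₀ hpos.ne'], ?_⟩
  intro y hy
  -- Hahn–Banach only separates `x` from the interior; the inequality reaches `B` because a convex
  -- set with nonempty interior lies in the closure of that interior.
  have hy' : y ∈ closure (interior B) := by
    rw [hB.closure_interior_eq_closure_of_nonempty_interior hne]
    exact subset_closure hy
  have hc : IsClosed {y : E | inner ℝ w y ≤ inner ℝ w x} :=
    isClosed_le (by fun_prop) continuous_const
  have h1 : inner ℝ w y ≤ inner ℝ w x := closure_minimal (fun a ha => (hf a ha).le) hc hy'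
  rw [real_inner_smul_left, real_inner_smul_left]
  exact mul_le_mul_of_nonneg_left h1 (by positivity)

/-- The set is the projection of a compact subset of frontier × sphere × sphere. Allowing a pair of
normals covers both the patches and the failure of uniqueness. -/
theorem isClosed_frontier_normal_pair [FiniteDimensional ℝ E] {B : Set E}
    (hB : Bornology.IsBounded B) {C : Set (E × E)} (hC : IsClosed C) :
    IsClosed {x | x ∈ frontier B ∧
      ∃ u v, IsOuterUnitNormal B x u ∧ IsOuterUnitNormal B x v ∧ (u, v) ∈ C} := by
  have hK : IsCompact (frontier B) := Metric.isCompact_of_isClosed_isBounded isClosed_frontier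
    (hB.closure.subset frontier_subset_closure)
  have hS : IsCompact (Metric.sphere (0 : E) 1) := isCompact_sphere 0 1
  have hcl : IsClosed {z : E × E × E | z.2 ∈ C ∧
      (∀ y ∈ B, inner ℝ z.2.1 y ≤ inner ℝ z.2.1 z.1) ∧
      (∀ y ∈ B, inner ℝ z.2.2 y ≤ inner ℝ z.2.2 z.1)} := by
    have h1 : IsClosed {z : E × E × E | ∀ y ∈ B, inner ℝ z.2.1 y ≤ inner ℝ z.2.1 z.1} := by
      rw [show {z : E × E × E | ∀ y ∈ B, inner ℝ z.2.1 y ≤ inner ℝ z.2.1 z.1} =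
        ⋂ y ∈ B, {z | inner ℝ z.2.1 y ≤ inner ℝ z.2.1 z.1} by ext; simp]
      exact isClosed_biInter fun y _ => isClosed_le (by fun_prop) (by fun_prop)
    have h2 : IsClosed {z : E × E × E | ∀ y ∈ B, inner ℝ z.2.2 y ≤ inner ℝ z.2.2 z.1} := by
      rw [show {z : E × E × E | ∀ y ∈ B, inner ℝ z.2.2 y ≤ inner ℝ z.2.2 z.1} =
        ⋂ y ∈ B, {z | inner ℝ z.2.2 y ≤ inner ℝ z.2.2 z.1} by ext; simp]
      exact isClosed_biInter fun y _ => isClosed_le (by fun_prop) (by fun_prop)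
    exact (hC.preimage continuous_snd).inter (h1.inter h2)
  have himg := (((hK.prod (hS.prod hS)).inter_right hcl).image continuous_fst).isClosed
  convert himg using 1
  ext x
  simp only [mem_ofPred_eq, mem_image, mem_inter_iff, mem_prod, mem_sphere_zero_iff_norm,
    IsOuterUnitNormal, Prod.exists]
  constructor
  · rintro ⟨hx, u, v, ⟨hu, hu'⟩, ⟨hv, hv'⟩, huv⟩
    exact ⟨x, u, v, ⟨⟨hx, hu, hv⟩, huv, hu', hv'⟩, rfl⟩
  · rintro ⟨x, u, v, ⟨⟨hx, hu, hv⟩, huv, hu', hv'⟩, rfl⟩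
    exact ⟨hx, u, v, ⟨hu, hu'⟩, ⟨hv, hv'⟩, huv⟩

/-- The boundary points having at least one outer unit normal. -/
def normalBoundary (B : Set E) : Set E :=
  {x | x ∈ frontier B ∧ ∃ u, IsOuterUnitNormal B x u}

/-- The boundary points having an outer unit normal within distance `ε` of `u`. -/
def normalPatch (B : Set E) (u : E) (ε : ℝ) : Set E :=
  {x | x ∈ frontier B ∧ ∃ v, IsOuterUnitNormal B x v ∧ ‖v - u‖ ≤ ε}

theorem essentialBoundary_subset_normalBoundary (B : Set E) :
    essentialBoundary B ⊆ normalBoundary B :=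
  fun _ hx => ⟨hx.1, hx.2.exists⟩

theorem isClosed_normalPatch [FiniteDimensional ℝ E] {B : Set E} (hB : Bornology.IsBounded B)
    (u : E) (ε : ℝ) : IsClosed (normalPatch B u ε) := by
  convert isClosed_frontier_normal_pair hB (C := {z | ‖z.1 - u‖ ≤ ε})
    (isClosed_le (by fun_prop) continuous_const) using 1
  ext x
  constructor
  · rintro ⟨hx, v, hv, h⟩
    exact ⟨hx, v, v, hv, hv, h⟩
  · rintro ⟨hx, v, _, hv, _, h⟩
    exact ⟨hx, v, hv, h⟩

theorem isClosed_normalBoundary [FiniteDimensional ℝ E] {B : Set E}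
    (hB : Bornology.IsBounded B) : IsClosed (normalBoundary B) := by
  convert isClosed_frontier_normal_pair hB isClosed_univ using 1
  ext x
  constructor
  · rintro ⟨hx, v, hv⟩
    exact ⟨hx, v, v, hv, hv, mem_univ _⟩
  · rintro ⟨hx, v, _, hv, _⟩
    exact ⟨hx, v, hv⟩

/-- Two distinct normals are at distance at least `1 / (k + 1)` for some `k`, so the bad points form
a countable union of closed sets. -/
theorem measurableSet_essentialBoundary [FiniteDimensional ℝ E] [MeasurableSpace E] [BorelSpace E]
    {B : Set E} (hB : Bornology.IsBounded B) : MeasurableSet (essentialBoundary B) := by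
  have h : essentialBoundary B = normalBoundary B \ ⋃ k : ℕ, {x | x ∈ frontier B ∧
      ∃ u v, IsOuterUnitNormal B x u ∧ IsOuterUnitNormal B x v ∧
        (u, v) ∈ {z : E × E | (1 : ℝ) / (k + 1) ≤ ‖z.1 - z.2‖}} := by
    ext x
    constructor
    · intro hx
      refine ⟨essentialBoundary_subset_normalBoundary B hx, ?_⟩
      simp only [mem_iUnion, mem_ofPred_eq, not_exists, not_and]
      intro k _ u v hu hv huv
      rw [hx.2.unique hu hv, sub_self, norm_zero] at huv
      have : (0 : ℝ) < 1 / (k + 1) := by positivity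
      linarith
    · rintro ⟨⟨hx, u, hu⟩, hn⟩
      refine ⟨hx, u, hu, fun v hv => ?_⟩
      by_contra hne
      obtain ⟨k, hk⟩ := exists_nat_one_div_lt (norm_pos_iff.2 (sub_ne_zero.2 hne))
      exact hn (mem_iUnion.2 ⟨k, hx, v, u, hv, hu, hk.le⟩)
  rw [h]
  refine (isClosed_normalBoundary hB).measurableSet.diff (MeasurableSet.iUnion fun k => ?_)
  exact (isClosed_frontier_normal_pair hB
    (isClosed_le continuous_const (by fun_prop))).measurableSet

/-- A normal `v` at `y` satisfies `⟪v, x - y⟫ ≤ 0`, and replacing `v` by `u` costs at most `ε * ‖x -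
y‖`. Hence, for small `ε`, a patch is almost flat over `u^⊥`. -/
theorem abs_inner_sub_le_of_mem_normalPatch {B : Set E} {u x y : E} {ε : ℝ}
    (hx : x ∈ normalPatch B u ε) (hy : y ∈ normalPatch B u ε) :
    |inner ℝ u (x - y)| ≤ ε * ‖x - y‖ := by
  have key : ∀ x y : E, x ∈ normalPatch B u ε → y ∈ normalPatch B u ε →
      inner ℝ u (x - y) ≤ ε * ‖x - y‖ := by
    rintro x y hx ⟨hy, v, hv, hvu⟩
    have h1 := hv.inner_le_of_mem_closure (frontier_subset_closure hx.1)
    have h2 : inner ℝ v (x - y) ≤ 0 := by rw [inner_sub_right]; linarith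
    have h3 : inner ℝ (u - v) (x - y) ≤ ‖u - v‖ * ‖x - y‖ := real_inner_le_norm _ _
    rw [norm_sub_rev] at h3
    have h4 : ‖v - u‖ * ‖x - y‖ ≤ ε * ‖x - y‖ := by gcongr
    rw [inner_sub_left] at h3
    linarith
  refine abs_le.2 ⟨?_, key x y hx hy⟩
  have := key y x hy hx
  rw [← neg_sub x y, inner_neg_right, norm_neg] at this
  linarith

end Normals

/-- The number of balls of radius `ε` needed to cover the unit sphere is bounded in terms of the
dimension. -/
theorem exists_cover_unit_sphere (k : ℕ) {ε : ℝ} (hε : 0 < ε) :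
    ∃ N : ℕ, ∀ (E : Type u) [NormedAddCommGroup E] [InnerProductSpace ℝ E]
      [FiniteDimensional ℝ E], Module.finrank ℝ E = k →
      ∃ w : Fin N → E, (∀ i, ‖w i‖ = 1) ∧ ∀ v : E, ‖v‖ = 1 → ∃ i, ‖v - w i‖ ≤ ε := by
  have hS : IsCompact (Metric.sphere (0 : EuclideanSpace ℝ (Fin k)) 1) := isCompact_sphere 0 1
  obtain ⟨t, htS, ht, hcov⟩ := hS.finite_cover_balls hε
  let t' := ht.toFinset
  refine ⟨t'.card, fun E _ _ _ hE => ?_⟩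
  -- The cover of the model sphere is transported by an isometry, so `N` does not depend on `E`.
  let e : E ≃ₗᵢ[ℝ] EuclideanSpace ℝ (Fin k) := (stdOrthonormalBasis ℝ E).repr.trans
    (LinearIsometryEquiv.piLpCongrLeft 2 ℝ ℝ (finCongr hE))
  refine ⟨fun i => e.symm (t'.equivFin.symm i), fun i => ?_, fun v hv => ?_⟩
  · rw [LinearIsometryEquiv.norm_map]
    have := htS (ht.mem_toFinset.1 (t'.equivFin.symm i).2)
    simpa using this
  · have : e v ∈ Metric.sphere (0 : EuclideanSpace ℝ (Fin k)) 1 := by simpa using hv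
    obtain ⟨x, hx, hvx⟩ := mem_iUnion₂.1 (hcov this)
    refine ⟨t'.equivFin ⟨x, ht.mem_toFinset.2 hx⟩, ?_⟩
    simp only [Equiv.symm_apply_apply]
    rw [← e.norm_map, map_sub, e.apply_symm_apply, ← dist_eq_norm]
    exact (Metric.mem_ball.1 hvx).le

/-- Continuous linear maps `p : V → E` and `q : V → F` exhibit the inner product space `V` as the
orthogonal direct sum of `E` and `F`. -/
structure IsOrthogonalSplitting {V E F : Type*} [NormedAddCommGroup V] [InnerProductSpace ℝ V]
    [NormedAddCommGroup E] [InnerProductSpace ℝ E] [NormedAddCommGroup F] [InnerProductSpace ℝ F]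
    (p : V →L[ℝ] E) (q : V →L[ℝ] F) : Prop where
  norm_sq : ∀ v, ‖v‖ ^ 2 = ‖p v‖ ^ 2 + ‖q v‖ ^ 2
  surj : ∀ a b, ∃ v, p v = a ∧ q v = b

/-! ### Boundary and normals of an orthogonal product -/

namespace IsOrthogonalSplitting

variable {V E F : Type*} [NormedAddCommGroup V] [InnerProductSpace ℝ V]
  [NormedAddCommGroup E] [InnerProductSpace ℝ E] [NormedAddCommGroup F] [InnerProductSpace ℝ F]
  {p : V →L[ℝ] E} {q : V →L[ℝ] F}

theorem symm (h : IsOrthogonalSplitting p q) : IsOrthogonalSplitting q p :=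
  ⟨fun v => by rw [h.norm_sq, add_comm], fun a b => by
    obtain ⟨v, hv⟩ := h.surj b a
    exact ⟨v, hv.symm⟩⟩

/-- The isometry onto the `L²` product given by an orthogonal splitting. -/
noncomputable def equiv (h : IsOrthogonalSplitting p q) : V ≃ₗᵢ[ℝ] WithLp 2 (E × F) :=
  LinearIsometryEquiv.ofSurjective
    { toLinearMap := (WithLp.linearEquiv 2 ℝ (E × F)).symm.toLinearMap ∘ₗ
        (p.toLinearMap.prod q.toLinearMap)
      norm_map' := fun v => by
        rw [← sq_eq_sq₀ (norm_nonneg _) (norm_nonneg _), h.norm_sq, WithLp.prod_norm_sq_eq_of_L2]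
        rfl }
    (fun z => by
      obtain ⟨v, h1, h2⟩ := h.surj z.fst z.snd
      refine ⟨v, ?_⟩
      apply (WithLp.linearEquiv 2 ℝ (E × F)).injective
      exact Prod.ext h1 h2)

theorem equiv_apply (h : IsOrthogonalSplitting p q) (v : V) :
    h.equiv v = WithLp.toLp 2 (p v, q v) := rfl

theorem inner_eq (h : IsOrthogonalSplitting p q) (v w : V) :
    inner ℝ v w = inner ℝ (p v) (p w) + inner ℝ (q v) (q w) := by
  rw [← h.equiv.inner_map_map, WithLp.prod_inner_apply]
  rfl

theorem ext (h : IsOrthogonalSplitting p q) {v w : V} (h1 : p v = p w) (h2 : q v = q w) :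
    v = w := by
  apply h.equiv.injective
  rw [equiv_apply, equiv_apply, h1, h2]

/-- The homeomorphism onto the product given by an orthogonal splitting. -/
noncomputable def homeomorph (h : IsOrthogonalSplitting p q) : V ≃ₜ E × F :=
  h.equiv.toHomeomorph.trans (WithLp.homeomorphProd 2 E F)

theorem preimage_prod (h : IsOrthogonalSplitting p q) (A : Set E) (B : Set F) :
    p ⁻¹' A ∩ q ⁻¹' B = h.homeomorph ⁻¹' (A ×ˢ B) := rfl

theorem closure_eq (h : IsOrthogonalSplitting p q) (A : Set E) (B : Set F) :
    closure (p ⁻¹' A ∩ q ⁻¹' B) = p ⁻¹' closure A ∩ q ⁻¹' closure B := by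
  rw [h.preimage_prod, h.preimage_prod, ← h.homeomorph.preimage_closure, closure_prod_eq]

theorem interior_eq (h : IsOrthogonalSplitting p q) (A : Set E) (B : Set F) :
    interior (p ⁻¹' A ∩ q ⁻¹' B) = p ⁻¹' interior A ∩ q ⁻¹' interior B := by
  rw [h.preimage_prod, h.preimage_prod, ← h.homeomorph.preimage_interior, interior_prod_eq]

theorem finrank_eq [FiniteDimensional ℝ E] [FiniteDimensional ℝ F]
    (h : IsOrthogonalSplitting p q) :
    Module.finrank ℝ V = Module.finrank ℝ E + Module.finrank ℝ F := by
  rw [h.equiv.toLinearEquiv.finrank_eq, (WithLp.linearEquiv 2 ℝ (E × F)).finrank_eq,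
    Module.finrank_prod]

/-- With the first component fixed, the functional `q w` is maximal over `B` at the interior point
`q v`, so it vanishes. -/
theorem isOuterUnitNormal_iff (h : IsOrthogonalSplitting p q) {A : Set E} {B : Set F} {v w : V}
    (hA : p v ∈ closure A) (hB : q v ∈ interior B) :
    IsOuterUnitNormal (p ⁻¹' A ∩ q ⁻¹' B) v w ↔
      q w = 0 ∧ IsOuterUnitNormal A (p v) (p w) := by
  constructor
  · intro hw
    have hq : q w = 0 := by
      refine eq_zero_of_forall_inner_le hB fun z hz => ?_
      obtain ⟨v', h1, h2⟩ := h.surj (p v) z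
      have hv' : v' ∈ closure (p ⁻¹' A ∩ q ⁻¹' B) := by
        rw [h.closure_eq]
        exact ⟨by rwa [mem_preimage, h1], by rw [mem_preimage, h2]; exact subset_closure hz⟩
      have := hw.inner_le_of_mem_closure hv'
      rw [h.inner_eq, h.inner_eq, h1, h2] at this
      linarith
    refine ⟨hq, ?_, fun y hy => ?_⟩
    · have := h.norm_sq w
      rw [hq, hw.1, norm_zero] at this
      rw [← sq_eq_sq₀ (norm_nonneg _) zero_le_one]
      linarith
    · obtain ⟨v', h1, h2⟩ := h.surj y (q v)
      have := hw.2 v' ⟨by rwa [mem_preimage, h1], by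
        rw [mem_preimage, h2]; exact interior_subset hB⟩
      rw [h.inner_eq, h.inner_eq, h1, h2] at this
      linarith
  · rintro ⟨hq, hp, hp'⟩
    refine ⟨?_, fun y hy => ?_⟩
    · have := h.norm_sq w
      rw [hq, hp, norm_zero] at this
      rw [← sq_eq_sq₀ (norm_nonneg _) zero_le_one]
      linarith
    · rw [h.inner_eq, h.inner_eq, hq, inner_zero_left, inner_zero_left, add_zero, add_zero]
      exact hp' _ hy.1

theorem mem_frontier_iff (h : IsOrthogonalSplitting p q) {A : Set E} {B : Set F} {v : V}
    (hB : q v ∈ interior B) : v ∈ frontier (p ⁻¹' A ∩ q ⁻¹' B) ↔ p v ∈ frontier A := by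
  have hB' : q v ∈ closure B := interior_subset_closure hB
  simp only [frontier, h.closure_eq, h.interior_eq]
  simp only [mem_sdiff, mem_inter_iff, mem_preimage, hB, hB', and_true]

theorem mem_essentialBoundary_iff (h : IsOrthogonalSplitting p q) {A : Set E} {B : Set F} {v : V}
    (hB : q v ∈ interior B) :
    v ∈ essentialBoundary (p ⁻¹' A ∩ q ⁻¹' B) ↔ p v ∈ essentialBoundary A := by
  unfold essentialBoundary
  rw [mem_ofPred_eq, mem_ofPred_eq, h.mem_frontier_iff hB]
  refine and_congr_right fun hv => ?_
  have hcl := frontier_subset_closure hv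
  constructor
  · rintro ⟨w, hw, huniq⟩
    refine ⟨p w, ((h.isOuterUnitNormal_iff hcl hB).1 hw).2, fun u hu => ?_⟩
    obtain ⟨w', h1, h2⟩ := h.surj u 0
    rw [← h1, huniq w' ((h.isOuterUnitNormal_iff hcl hB).2 ⟨h2, by rwa [h1]⟩)]
  · rintro ⟨u, hu, huniq⟩
    obtain ⟨w, h1, h2⟩ := h.surj u 0
    refine ⟨w, (h.isOuterUnitNormal_iff hcl hB).2 ⟨h2, by rwa [h1]⟩, fun w' hw' => ?_⟩
    obtain ⟨h3, h4⟩ := (h.isOuterUnitNormal_iff hcl hB).1 hw'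
    exact h.ext (by rw [h1]; exact huniq _ h4) (by rw [h2, h3])

theorem map_outerUnitNormal (h : IsOrthogonalSplitting p q) {A : Set E} {B : Set F} {v : V}
    (hB : q v ∈ interior B) (hv : v ∈ essentialBoundary (p ⁻¹' A ∩ q ⁻¹' B)) :
    q (outerUnitNormal (p ⁻¹' A ∩ q ⁻¹' B) v) = 0 ∧
      p (outerUnitNormal (p ⁻¹' A ∩ q ⁻¹' B) v) = outerUnitNormal A (p v) := by
  have hA := (h.mem_essentialBoundary_iff hB).1 hv
  have := (h.isOuterUnitNormal_iff (frontier_subset_closure hA.1) hB).1 (outerUnitNormal_spec hv)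
  exact ⟨this.1, eq_outerUnitNormal hA this.2⟩

/-- At the corners of a product there is more than one outer unit normal. -/
theorem mem_interior_of_mem_essentialBoundary [CompleteSpace E] [CompleteSpace F]
    (h : IsOrthogonalSplitting p q) {A : Set E} {B : Set F} {v : V} (hA : Convex ℝ A)
    (hA' : (interior A).Nonempty) (hB : Convex ℝ B) (hB' : (interior B).Nonempty)
    (hv : v ∈ essentialBoundary (p ⁻¹' A ∩ q ⁻¹' B)) (hq : q v ∉ interior B) :
    p v ∈ interior A := by
  by_contra hp
  obtain ⟨a, ha, ha'⟩ := exists_isOuterUnitNormal hA hA' hp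
  obtain ⟨b, hb, hb'⟩ := exists_isOuterUnitNormal hB hB' hq
  -- Extending the normals of the two factors by zero gives two different normals at `v`.
  obtain ⟨w₁, h11, h12⟩ := h.surj a 0
  obtain ⟨w₂, h21, h22⟩ := h.surj 0 b
  have hw₁ : IsOuterUnitNormal (p ⁻¹' A ∩ q ⁻¹' B) v w₁ := by
    refine ⟨?_, fun y hy => ?_⟩
    · have := h.norm_sq w₁
      rw [h11, h12, ha, norm_zero] at this
      rw [← sq_eq_sq₀ (norm_nonneg _) zero_le_one]
      linarith
    · rw [h.inner_eq, h.inner_eq, h12, h11, inner_zero_left, inner_zero_left, add_zero, add_zero]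
      exact ha' _ hy.1
  have hw₂ : IsOuterUnitNormal (p ⁻¹' A ∩ q ⁻¹' B) v w₂ := by
    refine ⟨?_, fun y hy => ?_⟩
    · have := h.norm_sq w₂
      rw [h21, h22, hb, norm_zero] at this
      rw [← sq_eq_sq₀ (norm_nonneg _) zero_le_one]
      linarith
    · rw [h.inner_eq, h.inner_eq, h21, h22, inner_zero_left, inner_zero_left, zero_add, zero_add]
      exact hb' _ hy.2
  have := hv.2.unique hw₁ hw₂
  rw [← h11, this, h21, norm_zero] at ha
  exact zero_ne_one ha

/-- An orthogonal splitting induces one of the hyperplane orthogonal to a vector of the first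
summand. -/
theorem exists_orthogonal (h : IsOrthogonalSplitting p q) {w : V} (hw : q w = 0) {u : E}
    (hu : p w = u) : ∃ (p' : (Submodule.span ℝ {w})ᗮ →L[ℝ] (Submodule.span ℝ {u})ᗮ)
      (q' : (Submodule.span ℝ {w})ᗮ →L[ℝ] F), IsOrthogonalSplitting p' q' ∧
      (∀ v, (p' v : E) = p v) ∧ ∀ v, q' v = q v := by
  have hmem : ∀ v : V, v ∈ (Submodule.span ℝ {w})ᗮ ↔ p v ∈ (Submodule.span ℝ {u})ᗮ := by
    intro v
    rw [Submodule.mem_orthogonal_singleton_iff_inner_right,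
      Submodule.mem_orthogonal_singleton_iff_inner_right, h.inner_eq, hw, hu, inner_zero_left,
      add_zero]
  refine ⟨(p.comp (Submodule.subtypeL _)).codRestrict _ fun v => (hmem v).1 v.2,
    q.comp (Submodule.subtypeL _), ⟨fun v => h.norm_sq v, fun a b => ?_⟩,
    fun _ => rfl, fun _ => rfl⟩
  obtain ⟨v, h1, h2⟩ := h.surj a b
  exact ⟨⟨v, (hmem v).2 (by rw [h1]; exact a.2)⟩, Subtype.ext h1, h2⟩

end IsOrthogonalSplitting

/-- A bounded convex set with the origin in its interior. -/
structure IsConvexBody₀ {E : Type*} [NormedAddCommGroup E] [InnerProductSpace ℝ E]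
    (B : Set E) : Prop where
  convex : Convex ℝ B
  isBounded : Bornology.IsBounded B
  zero_mem_interior : (0 : E) ∈ interior B

namespace IsConvexBody₀

variable {V E F : Type*} [NormedAddCommGroup V] [InnerProductSpace ℝ V]
  [NormedAddCommGroup E] [InnerProductSpace ℝ E] [NormedAddCommGroup F] [InnerProductSpace ℝ F]
  {p : V →L[ℝ] E} {q : V →L[ℝ] F} {A : Set E} {B : Set F}

theorem nonempty_interior (hA : IsConvexBody₀ A) : (interior A).Nonempty :=
  ⟨0, hA.zero_mem_interior⟩

theorem centralSection (hA : IsConvexBody₀ A) (ν : E) : IsConvexBody₀ (centralSection A ν) where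
  convex := hA.convex.linear_preimage (Submodule.subtype _)
  isBounded := by
    obtain ⟨R, hR⟩ := hA.isBounded.exists_norm_le
    exact isBounded_iff_forall_norm_le.2 ⟨R, fun y hy => hR _ hy⟩
  zero_mem_interior := by
    have : Continuous (Subtype.val : (Submodule.span ℝ {ν})ᗮ → E) := continuous_subtype_val
    exact preimage_interior_subset_interior_preimage this (by simpa using hA.zero_mem_interior)

theorem prod (hA : IsConvexBody₀ A) (hB : IsConvexBody₀ B) (h : IsOrthogonalSplitting p q) :
    IsConvexBody₀ (p ⁻¹' A ∩ q ⁻¹' B) where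
  convex := (hA.convex.linear_preimage p.toLinearMap).inter
    (hB.convex.linear_preimage q.toLinearMap)
  isBounded := by
    obtain ⟨R, hR⟩ := hA.isBounded.exists_norm_le
    obtain ⟨S, hS⟩ := hB.isBounded.exists_norm_le
    refine isBounded_iff_forall_norm_le.2 ⟨R + S, fun v hv => ?_⟩
    have h1 := hR _ hv.1
    have h2 := hS _ hv.2
    refine abs_le_of_sq_le_sq' ?_ (by linarith [norm_nonneg (p v), norm_nonneg (q v)]) |>.2
    rw [h.norm_sq]
    nlinarith [norm_nonneg (p v), norm_nonneg (q v)]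
  zero_mem_interior := by
    rw [h.interior_eq]
    exact ⟨by simpa using hA.zero_mem_interior, by simpa using hB.zero_mem_interior⟩

end IsConvexBody₀

section Product

variable {V E F : Type*} [NormedAddCommGroup V] [InnerProductSpace ℝ V]
  [NormedAddCommGroup E] [InnerProductSpace ℝ E] [NormedAddCommGroup F] [InnerProductSpace ℝ F]
  {p : V →L[ℝ] E} {q : V →L[ℝ] F} {A : Set E} {B : Set F}

/-- Corners have several normals, and points over both interiors are not on the frontier. The
factors are swapped on the right to match the splitting `h.symm`. -/
theorem IsOrthogonalSplitting.essentialBoundary_sdiff [CompleteSpace E] [CompleteSpace F]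
    (h : IsOrthogonalSplitting p q)
    (hA : IsConvexBody₀ A) (hB : IsConvexBody₀ B) :
    essentialBoundary (p ⁻¹' A ∩ q ⁻¹' B) \ q ⁻¹' interior B =
      essentialBoundary (q ⁻¹' B ∩ p ⁻¹' A) ∩ p ⁻¹' interior A := by
  rw [inter_comm (q ⁻¹' B)]
  ext v
  refine and_congr_right fun hv => ⟨fun hq => ?_, fun hp hq => ?_⟩
  · exact h.mem_interior_of_mem_essentialBoundary hA.convex hA.nonempty_interior hB.convex
      hB.nonempty_interior hv hq
  · refine hv.1.2 ?_
    rw [h.interior_eq]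
    exact ⟨hp, hq⟩

end Product

open scoped NNReal

/-! ### Hausdorff measure under Lipschitz maps and projections -/

section Lipschitz

variable {X Y : Type*} [EMetricSpace X] [MeasurableSpace X] [BorelSpace X]
  [EMetricSpace Y] [MeasurableSpace Y] [BorelSpace Y]

theorem LipschitzOnWith.euclideanHausdorffMeasure_image_le {f : X → Y} {s : Set X} {K : ℝ≥0}
    (h : LipschitzOnWith K f s) (d : ℕ) :
    (μHE[d] : Measure Y) (f '' s) ≤ (K : ℝ≥0∞) ^ d * (μHE[d] : Measure X) s := by
  have := h.hausdorffMeasure_image_le (d := d) (Nat.cast_nonneg d)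
  rw [ENNReal.rpow_natCast] at this
  simp only [Measure.euclideanHausdorffMeasure_def, Measure.smul_apply, ENNReal.smul_def,
    smul_eq_mul]
  calc _ ≤ _ * ((K : ℝ≥0∞) ^ d * (μH[d] : Measure X) s) := mul_le_mul_right this _
    _ = _ := by ring

theorem euclideanHausdorffMeasure_le_mul_image {f : X → Y} {s : Set X} {K : ℝ≥0}
    (h : ∀ x ∈ s, ∀ y ∈ s, edist x y ≤ K * edist (f x) (f y)) (d : ℕ) :
    (μHE[d] : Measure X) s ≤ (K : ℝ≥0∞) ^ d * (μHE[d] : Measure Y) (f '' s) := by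
  have hanti : AntilipschitzWith K (s.domRestrict f) := fun x y => h x x.2 y y.2
  have := hanti.le_hausdorffMeasure_image (d := d) (Nat.cast_nonneg d) univ
  rw [ENNReal.rpow_natCast, image_univ, range_domRestrict,
    ← (isometry_subtype_coe (s := s)).hausdorffMeasure_image (Or.inl (Nat.cast_nonneg d)),
    image_univ, Subtype.range_coe] at this
  simp only [Measure.euclideanHausdorffMeasure_def, Measure.smul_apply, ENNReal.smul_def,
    smul_eq_mul]
  calc _ ≤ _ * ((K : ℝ≥0∞) ^ d * (μH[d] : Measure Y) (f '' s)) := mul_le_mul_right this _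
    _ = _ := by ring

end Lipschitz

theorem norm_sq_eq_inner_sq_add_projection {E : Type*} [NormedAddCommGroup E]
    [InnerProductSpace ℝ E] [FiniteDimensional ℝ E] {w : E} (hw : ‖w‖ = 1) (x : E) :
    ‖x‖ ^ 2 = inner ℝ w x ^ 2 + ‖(Submodule.span ℝ {w})ᗮ.orthogonalProjectionOnto x‖ ^ 2 := by
  rw [Submodule.norm_sq_eq_add_norm_sq_projection x (Submodule.span ℝ {w})]
  congr 1
  rw [← Submodule.norm_coe, Submodule.coe_orthogonalProjectionOnto_apply,
    Submodule.starProjection_unit_singleton ℝ hw, norm_smul, hw, mul_one, Real.norm_eq_abs, sq_abs]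

theorem norm_sub_le_mul_norm_projection {E : Type*} [NormedAddCommGroup E]
    [InnerProductSpace ℝ E] [FiniteDimensional ℝ E] {w : E} (hw : ‖w‖ = 1) {ε : ℝ} {K : ℝ≥0}
    (hK : 1 ≤ (K : ℝ) ^ 2 * (1 - ε ^ 2)) {x y : E}
    (hxy : |inner ℝ w (x - y)| ≤ ε * ‖x - y‖) :
    ‖x - y‖ ^ 2 ≤
      (K : ℝ) ^ 2 * ‖(Submodule.span ℝ {w})ᗮ.orthogonalProjectionOnto (x - y)‖ ^ 2 := by
  have h1 := norm_sq_eq_inner_sq_add_projection hw (x - y)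
  have h2 : inner ℝ w (x - y) ^ 2 ≤ (ε * ‖x - y‖) ^ 2 := by
    rw [← sq_abs]
    gcongr
  have h3 : (1 - ε ^ 2) * ‖x - y‖ ^ 2 ≤
    ‖(Submodule.span ℝ {w})ᗮ.orthogonalProjectionOnto (x - y)‖ ^ 2 := by linarith
  calc ‖x - y‖ ^ 2 ≤ ((K : ℝ) ^ 2 * (1 - ε ^ 2)) * ‖x - y‖ ^ 2 :=
        le_mul_of_one_le_left (sq_nonneg _) hK
    _ = (K : ℝ) ^ 2 * ((1 - ε ^ 2) * ‖x - y‖ ^ 2) := by ring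
    _ ≤ _ := by gcongr

theorem edist_le_of_norm_sq_le {E' F' : Type*} [NormedAddCommGroup E'] [NormedAddCommGroup F']
    {x y : E'} {x' y' : F'} {K : ℝ≥0} (h : ‖x - y‖ ^ 2 ≤ (K : ℝ) ^ 2 * ‖x' - y'‖ ^ 2) :
    edist x y ≤ K * edist x' y' := by
  rw [edist_nndist, edist_nndist, ← ENNReal.coe_mul, ENNReal.coe_le_coe, ← NNReal.coe_le_coe,
    NNReal.coe_mul, coe_nndist, coe_nndist, dist_eq_norm, dist_eq_norm]
  rw [← mul_pow] at h
  exact (sq_le_sq₀ (norm_nonneg _) (by positivity)).1 h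

namespace IsOrthogonalSplitting

variable {V E F : Type*} [NormedAddCommGroup V] [InnerProductSpace ℝ V]
  [NormedAddCommGroup E] [InnerProductSpace ℝ E] [NormedAddCommGroup F] [InnerProductSpace ℝ F]
  [MeasurableSpace V] [BorelSpace V] [MeasurableSpace E] [BorelSpace E]
  [MeasurableSpace F] [BorelSpace F]
  [FiniteDimensional ℝ V] [FiniteDimensional ℝ E] [FiniteDimensional ℝ F]
  {p : V →L[ℝ] E} {q : V →L[ℝ] F}

theorem measurePreserving (h : IsOrthogonalSplitting p q) :
    MeasurePreserving h.homeomorph (volume : Measure V) (volume.prod volume) :=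
  (WithLp.volume_preserving_ofLp E F).comp h.equiv.measurePreserving

/-- The volume of a product set. -/
theorem euclideanHausdorffMeasure_prod (h : IsOrthogonalSplitting p q) {n m : ℕ}
    (hn : Module.finrank ℝ E = n) (hm : Module.finrank ℝ F = m) (A : Set E) (B : Set F) :
    (μHE[n + m] : Measure V) (p ⁻¹' A ∩ q ⁻¹' B) =
      (μHE[n] : Measure E) A * (μHE[m] : Measure F) B := by
  have hV := h.finrank_eq
  subst hn hm
  rw [← hV, InnerProductSpace.euclideanHausdorffMeasure_eq_volume,
    InnerProductSpace.euclideanHausdorffMeasure_eq_volume,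
    InnerProductSpace.euclideanHausdorffMeasure_eq_volume, h.preimage_prod,
    h.measurePreserving.measure_preimage_emb h.homeomorph.measurableEmbedding, Measure.prod_prod]

end IsOrthogonalSplitting

theorem isOrthogonalSplitting_withLp (E F : Type*)
    [NormedAddCommGroup E] [InnerProductSpace ℝ E] [NormedAddCommGroup F] [InnerProductSpace ℝ F] :
    IsOrthogonalSplitting
      ((ContinuousLinearMap.fst ℝ E F).comp
        (WithLp.prodContinuousLinearEquiv 2 ℝ E F).toContinuousLinearMap)
      ((ContinuousLinearMap.snd ℝ E F).comp
        (WithLp.prodContinuousLinearEquiv 2 ℝ E F).toContinuousLinearMap) where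
  norm_sq v := WithLp.prod_norm_sq_eq_of_L2 v
  surj a b := ⟨WithLp.toLp 2 (a, b), rfl, rfl⟩

/-! ### Almost flat sets -/

section AlmostFlat

variable {V E F : Type*} [NormedAddCommGroup V] [InnerProductSpace ℝ V]
  [NormedAddCommGroup E] [InnerProductSpace ℝ E] [NormedAddCommGroup F] [InnerProductSpace ℝ F]
  [MeasurableSpace V] [BorelSpace V] [MeasurableSpace E] [BorelSpace E]
  [MeasurableSpace F] [BorelSpace F]
  [FiniteDimensional ℝ E] [FiniteDimensional ℝ F]
  {p : V →L[ℝ] E} {q : V →L[ℝ] F}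

theorem euclideanHausdorffMeasure_le_mul_projection {w : E} (hw : ‖w‖ = 1) {ε : ℝ} {K : ℝ≥0}
    (hK : 1 ≤ (K : ℝ) ^ 2 * (1 - ε ^ 2)) {T : Set E}
    (hT : ∀ x ∈ T, ∀ y ∈ T, |inner ℝ w (x - y)| ≤ ε * ‖x - y‖) (n : ℕ) :
    (μHE[n] : Measure E) T ≤ (K : ℝ≥0∞) ^ n * (μHE[n] : Measure (Submodule.span ℝ {w})ᗮ)
      ((Submodule.span ℝ {w})ᗮ.orthogonalProjectionOnto '' T) := by
  refine euclideanHausdorffMeasure_le_mul_image (fun x hx y hy => edist_le_of_norm_sq_le ?_) n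
  rw [← map_sub]
  exact norm_sub_le_mul_norm_projection hw hK (hT x hx y hy)

/-- Projecting `T` along `w` sends `T × W` into a Euclidean space of dimension `n + m`, where the
measure is volume and multiplies exactly. The projection is 1-Lipschitz with `K`-Lipschitz inverse
on `T`, so each comparison costs at most a power of `K`. -/
theorem IsOrthogonalSplitting.euclideanHausdorffMeasure_almost_flat
    (h : IsOrthogonalSplitting p q) {n m : ℕ} (hn : Module.finrank ℝ E = n + 1)
    (hm : Module.finrank ℝ F = m) {w : E} (hw : ‖w‖ = 1) {ε : ℝ} {K : ℝ≥0}
    (hK1 : 1 ≤ K) (hK : 1 ≤ (K : ℝ) ^ 2 * (1 - ε ^ 2)) {T : Set E}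
    (hT : ∀ x ∈ T, ∀ y ∈ T, |inner ℝ w (x - y)| ≤ ε * ‖x - y‖) (W : Set F) :
    (μHE[n + m] : Measure V) (p ⁻¹' T ∩ q ⁻¹' W) ≤
        (K : ℝ≥0∞) ^ (n + m) * ((μHE[n] : Measure E) T * (μHE[m] : Measure F) W) ∧
      (μHE[n] : Measure E) T * (μHE[m] : Measure F) W ≤
        (K : ℝ≥0∞) ^ (n + m) * (μHE[n + m] : Measure V) (p ⁻¹' T ∩ q ⁻¹' W) := by
  set S := (Submodule.span ℝ {w})ᗮ with hS
  have hfin : Module.finrank ℝ S = n := by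
    have : Fact (Module.finrank ℝ E = n + 1) := ⟨hn⟩
    exact Submodule.finrank_orthogonal_span_singleton (norm_ne_zero_iff.1 (by rw [hw]; simp))
  let P := S.orthogonalProjectionOnto
  let Φ : V → WithLp 2 (S × F) := fun v => WithLp.toLp 2 (P (p v), q v)
  have hΦ : ∀ v v' : V, ‖Φ v - Φ v'‖ ^ 2 = ‖P (p v - p v')‖ ^ 2 + ‖q v - q v'‖ ^ 2 := by
    intro v v'
    rw [WithLp.prod_norm_sq_eq_of_L2, map_sub]
    rfl
  have hP : ∀ x : E, ‖P x‖ ^ 2 ≤ ‖x‖ ^ 2 := fun x => by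
    rw [norm_sq_eq_inner_sq_add_projection hw x]
    exact le_add_of_nonneg_left (sq_nonneg _)
  have himg : Φ '' (p ⁻¹' T ∩ q ⁻¹' W) =
      ((ContinuousLinearMap.fst ℝ S F).comp
        (WithLp.prodContinuousLinearEquiv 2 ℝ S F).toContinuousLinearMap) ⁻¹' (P '' T) ∩
      ((ContinuousLinearMap.snd ℝ S F).comp
        (WithLp.prodContinuousLinearEquiv 2 ℝ S F).toContinuousLinearMap) ⁻¹' W := by
    ext z
    constructor
    · rintro ⟨v, hv, rfl⟩
      exact ⟨⟨p v, hv.1, rfl⟩, hv.2⟩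
    · rintro ⟨⟨a, ha, ha'⟩, hb⟩
      obtain ⟨v, h1, h2⟩ := h.surj a z.snd
      refine ⟨v, ⟨by rwa [mem_preimage, h1], by rw [mem_preimage, h2]; exact hb⟩, ?_⟩
      apply (WithLp.linearEquiv 2 ℝ (S × F)).injective
      refine Prod.ext ?_ h2
      change P (p v) = _
      rw [h1]
      exact ha'
  have hprod : (μHE[n + m] : Measure _) (Φ '' (p ⁻¹' T ∩ q ⁻¹' W)) =
      (μHE[n] : Measure S) (P '' T) * (μHE[m] : Measure F) W := by
    rw [himg]
    exact (isOrthogonalSplitting_withLp S F).euclideanHausdorffMeasure_prod hfin hm _ _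
  have hlow : (μHE[n + m] : Measure _) (Φ '' (p ⁻¹' T ∩ q ⁻¹' W)) ≤
      (μHE[n + m] : Measure V) (p ⁻¹' T ∩ q ⁻¹' W) := by
    have : LipschitzOnWith 1 Φ (p ⁻¹' T ∩ q ⁻¹' W) := by
      refine fun x hx y hy => edist_le_of_norm_sq_le ?_
      rw [hΦ, h.norm_sq, map_sub p, map_sub q, NNReal.coe_one, one_pow, one_mul]
      exact add_le_add (hP (p x - p y)) le_rfl
    simpa using this.euclideanHausdorffMeasure_image_le (n + m)
  have hup : (μHE[n + m] : Measure V) (p ⁻¹' T ∩ q ⁻¹' W) ≤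
      (K : ℝ≥0∞) ^ (n + m) * (μHE[n + m] : Measure _) (Φ '' (p ⁻¹' T ∩ q ⁻¹' W)) := by
    refine euclideanHausdorffMeasure_le_mul_image (fun x hx y hy => edist_le_of_norm_sq_le ?_) _
    rw [hΦ, h.norm_sq, map_sub p, map_sub q, mul_add]
    have hK1' : (1 : ℝ) ≤ (K : ℝ) ^ 2 := one_le_pow₀ (by exact_mod_cast hK1)
    exact add_le_add (norm_sub_le_mul_norm_projection hw hK (hT _ hx.1 _ hy.1))
      (le_mul_of_one_le_left (sq_nonneg _) hK1')
  have hTlow : (μHE[n] : Measure S) (P '' T) ≤ (μHE[n] : Measure E) T := by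
    have : LipschitzOnWith 1 P T := by
      refine fun x hx y hy => edist_le_of_norm_sq_le ?_
      rw [← map_sub, NNReal.coe_one, one_pow, one_mul]
      exact hP _
    simpa using this.euclideanHausdorffMeasure_image_le n
  have hTup := euclideanHausdorffMeasure_le_mul_projection hw hK hT n
  rw [hprod] at hlow hup
  constructor
  · exact hup.trans (by gcongr)
  · have hK1' : (1 : ℝ≥0∞) ≤ (K : ℝ≥0∞) := by exact_mod_cast hK1
    calc (μHE[n] : Measure E) T * (μHE[m] : Measure F) W
        ≤ (K : ℝ≥0∞) ^ n * (μHE[n] : Measure S) (P '' T) * (μHE[m] : Measure F) W := by gcongr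
      _ = (K : ℝ≥0∞) ^ n * ((μHE[n] : Measure S) (P '' T) * (μHE[m] : Measure F) W) := by ring
      _ ≤ (K : ℝ≥0∞) ^ (n + m) * (μHE[n + m] : Measure V) (p ⁻¹' T ∩ q ⁻¹' W) := by
          gcongr
          exact Nat.le_add_right _ _

end AlmostFlat

/-! ### Boundary area bounds and integration tools -/

theorem normalBoundary_subset_iUnion_normalPatch {E ι : Type*} [NormedAddCommGroup E]
    [InnerProductSpace ℝ E] {w : ι → E} {ε : ℝ}
    (hw : ∀ v : E, ‖v‖ = 1 → ∃ i, ‖v - w i‖ ≤ ε) (A : Set E) :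
    normalBoundary A ⊆ ⋃ i, normalPatch A (w i) ε := by
  rintro x ⟨hx, v, hv⟩
  obtain ⟨i, hi⟩ := hw v hv.1
  exact mem_iUnion.2 ⟨i, hx, v, hv, hi⟩

theorem euclideanHausdorffMeasure_ball {E : Type*} [NormedAddCommGroup E]
    [InnerProductSpace ℝ E] [FiniteDimensional ℝ E] [MeasurableSpace E] [BorelSpace E] {k : ℕ}
    (hE : Module.finrank ℝ E = k) (r : ℝ) : (μHE[k] : Measure E) (Metric.ball 0 r) =
      volume (Metric.ball (0 : EuclideanSpace ℝ (Fin k)) r) := by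
  subst hE
  have e := (stdOrthonormalBasis ℝ E).repr
  rw [← EuclideanSpace.euclideanHausdorffMeasure_eq_volume,
    ← e.isometry.euclideanHausdorffMeasure_image, e.image_ball, map_zero]

/-- Boundedly many patches cover the boundary, and each is the image under a 2-Lipschitz map of a
subset of a hyperplane ball. Radius `R + 1` only serves to make the ball open. -/
theorem exists_normalBoundary_measure_bound (n : ℕ) (R : ℝ) :
    ∃ C : ℝ≥0∞, C ≠ ∞ ∧ ∀ (E : Type u) [NormedAddCommGroup E] [InnerProductSpace ℝ E]
      [FiniteDimensional ℝ E] [MeasurableSpace E] [BorelSpace E], Module.finrank ℝ E = n + 1 →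
      ∀ A : Set E, (∀ x ∈ A, ‖x‖ ≤ R) → (μHE[n] : Measure E) (normalBoundary A) ≤ C := by
  obtain ⟨N, hN⟩ := exists_cover_unit_sphere.{u} (n + 1) (ε := 1 / 2) (by norm_num)
  refine ⟨N * (((2 : ℝ≥0) : ℝ≥0∞) ^ n * volume (Metric.ball (0 : EuclideanSpace ℝ (Fin n)) (R + 1))),
    ENNReal.mul_ne_top (ENNReal.natCast_ne_top N) (ENNReal.mul_ne_top
      (ENNReal.pow_ne_top ENNReal.coe_ne_top) Metric.isBounded_ball.measure_lt_top.ne), ?_⟩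
  intro E _ _ _ _ _ hE A hA
  obtain ⟨w, hw1, hw2⟩ := hN E hE
  have hcl : closure A ⊆ Metric.closedBall 0 R :=
    closure_minimal (fun x hx => by simpa using hA x hx) Metric.isClosed_closedBall
  have hpatch : ∀ i, (μHE[n] : Measure E) (normalPatch A (w i) (1 / 2)) ≤
      ((2 : ℝ≥0) : ℝ≥0∞) ^ n * volume (Metric.ball (0 : EuclideanSpace ℝ (Fin n)) (R + 1)) := by
    intro i
    refine (euclideanHausdorffMeasure_le_mul_projection (hw1 i) (ε := 1 / 2) (K := 2)
      (by norm_num) (fun x hx y hy => abs_inner_sub_le_of_mem_normalPatch hx hy) n).trans ?_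
    have hfin : Module.finrank ℝ (Submodule.span ℝ {w i})ᗮ = n := by
      have : Fact (Module.finrank ℝ E = n + 1) := ⟨hE⟩
      exact Submodule.finrank_orthogonal_span_singleton (norm_ne_zero_iff.1 (by rw [hw1]; simp))
    rw [← euclideanHausdorffMeasure_ball hfin]
    gcongr
    rintro _ ⟨x, hx, rfl⟩
    have h1 := hcl (frontier_subset_closure hx.1)
    rw [mem_closedBall_zero_iff] at h1
    rw [mem_ball_zero_iff]
    have h2 := (Submodule.span ℝ {w i})ᗮ.norm_orthogonalProjectionOnto_apply_le x
    linarith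
  calc (μHE[n] : Measure E) (normalBoundary A)
      ≤ (μHE[n] : Measure E) (⋃ i, normalPatch A (w i) (1 / 2)) :=
        measure_mono (normalBoundary_subset_iUnion_normalPatch hw2 A)
    _ ≤ ∑ i, (μHE[n] : Measure E) (normalPatch A (w i) (1 / 2)) := measure_iUnion_fintype_le _ _
    _ ≤ ∑ _i : Fin N, _ := Finset.sum_le_sum fun i _ => hpatch i
    _ = _ := by simp

theorem le_of_forall_le_pow_mul {a b : ℝ≥0∞} (k : ℕ)
    (h : ∀ K : ℝ≥0, 1 < K → a ≤ (K : ℝ≥0∞) ^ k * b) : a ≤ b := by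
  have hlim : Filter.Tendsto (fun K : ℝ≥0 => (K : ℝ≥0∞) ^ k * b) (nhdsWithin 1 (Ioi 1))
      (nhds (((1 : ℝ≥0) : ℝ≥0∞) ^ k * b)) := by
    refine ENNReal.Tendsto.mul_const ?_ (Or.inl (by simp))
    have : Continuous fun K : ℝ≥0 => (K : ℝ≥0∞) ^ k := by fun_prop
    exact (this.tendsto 1).mono_left nhdsWithin_le_nhds
  rw [ENNReal.coe_one, one_pow, one_mul] at hlim
  exact ge_of_tendsto hlim (eventually_nhdsWithin_of_forall h)

theorem exists_flatness {K : ℝ≥0} (hK : 1 < K) :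
    ∃ ε : ℝ, 0 < ε ∧ 1 ≤ (K : ℝ) ^ 2 * (1 - ε ^ 2) := by
  have hK' : (1 : ℝ) < (K : ℝ) ^ 2 := one_lt_pow₀ (by exact_mod_cast hK) two_ne_zero
  have hpos : (0 : ℝ) < 1 - ((K : ℝ) ^ 2)⁻¹ := sub_pos.2 (inv_lt_one_of_one_lt₀ hK')
  -- This `ε` gives equality in the required bound.
  refine ⟨√(1 - ((K : ℝ) ^ 2)⁻¹), Real.sqrt_pos.2 hpos, ?_⟩
  rw [Real.sq_sqrt hpos.le, sub_sub_cancel, mul_inv_cancel₀ (by positivity)]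

/-- No measurability of `g` is needed, so none has to be shown for the density. For `≤`, Tonelli is
applied to a measurable minorant with the same integral; `≥` comes from the pushforward under
`Prod.fst`. -/
theorem lintegral_prod_comp_fst {α β : Type*} [MeasurableSpace α] [MeasurableSpace β]
    (μ : Measure α) (ν : Measure β) [SFinite μ] [IsFiniteMeasure ν] (g : α → ℝ≥0∞) :
    ∫⁻ z, g z.1 ∂(μ.prod ν) = (∫⁻ x, g x ∂μ) * ν univ := by
  apply le_antisymm
  · obtain ⟨f, hf, hfg, hint⟩ := exists_measurable_le_lintegral_eq (μ := μ.prod ν) fun z => g z.1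
    rw [hint, lintegral_prod _ hf.aemeasurable,
      ← lintegral_mul_const' _ _ (measure_ne_top ν univ)]
    refine lintegral_mono fun x => ?_
    calc ∫⁻ y, f (x, y) ∂ν ≤ ∫⁻ _, g x ∂ν := lintegral_mono fun y => hfg (x, y)
      _ = g x * ν univ := lintegral_const _
  · have := lintegral_map_le (μ := μ.prod ν) g Prod.fst
    rwa [Measure.map_fst_prod, lintegral_smul_measure, smul_eq_mul, mul_comm] at this

/-! ### Product measure on boundary pieces -/

namespace IsOrthogonalSplitting

variable {V E F : Type*} [NormedAddCommGroup V] [InnerProductSpace ℝ V]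
  [NormedAddCommGroup E] [InnerProductSpace ℝ E] [NormedAddCommGroup F] [InnerProductSpace ℝ F]
  [MeasurableSpace V] [BorelSpace V] [MeasurableSpace E] [BorelSpace E]
  [MeasurableSpace F] [BorelSpace F]
  [FiniteDimensional ℝ E] [FiniteDimensional ℝ F]
  {p : V →L[ℝ] E} {q : V →L[ℝ] F}

/-- The area of the product of a piece of the boundary of a convex body with a measurable set. -/
theorem euclideanHausdorffMeasure_normalBoundary_prod (h : IsOrthogonalSplitting p q) {n m : ℕ}
    (hn : Module.finrank ℝ E = n + 1) (hm : Module.finrank ℝ F = m) {A : Set E}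
    (hA : Bornology.IsBounded A) {T : Set E} (hT : MeasurableSet T) (hTA : T ⊆ normalBoundary A)
    {W : Set F} (hW : MeasurableSet W) :
    (μHE[n + m] : Measure V) (p ⁻¹' T ∩ q ⁻¹' W) =
      (μHE[n] : Measure E) T * (μHE[m] : Measure F) W := by
  have key : ∀ K : ℝ≥0, 1 < K → (μHE[n + m] : Measure V) (p ⁻¹' T ∩ q ⁻¹' W) ≤
        (K : ℝ≥0∞) ^ (n + m) * ((μHE[n] : Measure E) T * (μHE[m] : Measure F) W) ∧
      (μHE[n] : Measure E) T * (μHE[m] : Measure F) W ≤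
        (K : ℝ≥0∞) ^ (n + m) * (μHE[n + m] : Measure V) (p ⁻¹' T ∩ q ⁻¹' W) := by
    intro K hK
    obtain ⟨ε, hε, hKε⟩ := exists_flatness hK
    obtain ⟨N, hN⟩ := exists_cover_unit_sphere (n + 1) hε
    obtain ⟨w, hw1, hw2⟩ := hN E hn
    let S : ℕ → Set E := fun i => if hi : i < N then normalPatch A (w ⟨i, hi⟩) ε else ∅
    have hS : ∀ i, MeasurableSet (S i) := by
      intro i
      by_cases hi : i < N
      · simp only [S, hi, dif_pos]
        exact (isClosed_normalPatch hA _ _).measurableSet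
      · simp [S, hi]
    have hTS : T ⊆ ⋃ i, S i := by
      intro x hx
      obtain ⟨i, hi⟩ := mem_iUnion.1 (normalBoundary_subset_iUnion_normalPatch hw2 A (hTA hx))
      exact mem_iUnion.2 ⟨i, by simpa [S] using hi⟩
    -- Disjoint measurable pieces, each inside a single patch; the family is padded with empty sets
    -- beyond `N`.
    let D : ℕ → Set E := fun i => T ∩ disjointed S i
    have hDm : ∀ i, MeasurableSet (D i) := fun i => hT.inter (MeasurableSet.disjointed hS i)
    have hDd : Pairwise (Function.onFun Disjoint D) := fun i j hij =>
      (disjoint_disjointed S hij).mono inter_subset_right inter_subset_right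
    have hDT : T = ⋃ i, D i := by
      rw [← inter_iUnion, iUnion_disjointed, inter_eq_left.2 hTS]
    have hsumT : (μHE[n] : Measure E) T = ∑' i, (μHE[n] : Measure E) (D i) := by
      conv_lhs => rw [hDT]
      exact measure_iUnion hDd hDm
    have hsumV : (μHE[n + m] : Measure V) (p ⁻¹' T ∩ q ⁻¹' W) =
        ∑' i, (μHE[n + m] : Measure V) (p ⁻¹' D i ∩ q ⁻¹' W) := by
      conv_lhs => rw [hDT, preimage_iUnion, iUnion_inter]
      refine measure_iUnion (fun i j hij => ?_) fun i => ?_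
      · exact ((hDd hij).preimage p).mono inter_subset_left inter_subset_left
      · exact (p.continuous.measurable (hDm i)).inter (q.continuous.measurable hW)
    have hpiece : ∀ i, (μHE[n + m] : Measure V) (p ⁻¹' D i ∩ q ⁻¹' W) ≤
          (K : ℝ≥0∞) ^ (n + m) * ((μHE[n] : Measure E) (D i) * (μHE[m] : Measure F) W) ∧
        (μHE[n] : Measure E) (D i) * (μHE[m] : Measure F) W ≤
          (K : ℝ≥0∞) ^ (n + m) * (μHE[n + m] : Measure V) (p ⁻¹' D i ∩ q ⁻¹' W) := by
      intro i
      have hsub : D i ⊆ S i := inter_subset_right.trans (disjointed_subset S i)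
      by_cases hi : i < N
      · simp only [S, hi, dif_pos] at hsub
        exact h.euclideanHausdorffMeasure_almost_flat hn hm (hw1 _) hK.le hKε
          (fun x hx y hy => abs_inner_sub_le_of_mem_normalPatch (hsub hx) (hsub hy)) W
      · simp only [S, hi, dif_neg, not_false_eq_true, subset_empty_iff] at hsub
        simp [hsub]
    rw [hsumT, hsumV, ← ENNReal.tsum_mul_right, ← ENNReal.tsum_mul_left, ← ENNReal.tsum_mul_left]
    exact ⟨ENNReal.tsum_le_tsum fun i => (hpiece i).1, ENNReal.tsum_le_tsum fun i => (hpiece i).2⟩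
  -- Both inequalities become exact as `K` tends to 1.
  exact le_antisymm (le_of_forall_le_pow_mul (n + m) fun K hK => (key K hK).1)
    (le_of_forall_le_pow_mul (n + m) fun K hK => (key K hK).2)

theorem map_restrict_normalBoundary_prod (h : IsOrthogonalSplitting p q) {n m : ℕ}
    (hn : Module.finrank ℝ E = n + 1) (hm : Module.finrank ℝ F = m) {A : Set E}
    (hA : Bornology.IsBounded A) {S : Set E} (hS : MeasurableSet S) (hSA : S ⊆ normalBoundary A)
    [IsFiniteMeasure ((μHE[n] : Measure E).restrict S)]
    {W : Set F} (hW : MeasurableSet W) [IsFiniteMeasure ((μHE[m] : Measure F).restrict W)] :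
    Measure.map h.homeomorph ((μHE[n + m] : Measure V).restrict (p ⁻¹' S ∩ q ⁻¹' W)) =
      ((μHE[n] : Measure E).restrict S).prod ((μHE[m] : Measure F).restrict W) := by
  symm
  refine Measure.prod_eq fun s t hs ht => ?_
  have hpre : h.homeomorph ⁻¹' (s ×ˢ t) = p ⁻¹' s ∩ q ⁻¹' t := rfl
  rw [Measure.map_apply h.homeomorph.measurable (hs.prod ht), hpre,
    Measure.restrict_apply ((p.continuous.measurable hs).inter (q.continuous.measurable ht)),
    Measure.restrict_apply hs, Measure.restrict_apply ht, inter_inter_inter_comm,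
    ← preimage_inter, ← preimage_inter]
  exact h.euclideanHausdorffMeasure_normalBoundary_prod hn hm hA (hs.inter hS)
    (inter_subset_right.trans hSA) (ht.inter hW)

theorem setLIntegral_normalBoundary_prod (h : IsOrthogonalSplitting p q) {n m : ℕ}
    (hn : Module.finrank ℝ E = n + 1) (hm : Module.finrank ℝ F = m) {A : Set E}
    (hA : Bornology.IsBounded A) {S : Set E} (hS : MeasurableSet S) (hSA : S ⊆ normalBoundary A)
    {W : Set F} (hW : MeasurableSet W) (hWb : Bornology.IsBounded W) (g : E → ℝ≥0∞) :
    ∫⁻ v in p ⁻¹' S ∩ q ⁻¹' W, g (p v) ∂(μHE[n + m] : Measure V) =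
      (∫⁻ x in S, g x ∂μHE[n]) * (μHE[m] : Measure F) W := by
  have hfS : IsFiniteMeasure ((μHE[n] : Measure E).restrict S) := by
    obtain ⟨R, hR⟩ := hA.exists_norm_le
    obtain ⟨C, hC, hC'⟩ := exists_normalBoundary_measure_bound n R
    rw [isFiniteMeasure_restrict]
    exact (((measure_mono hSA).trans (hC' E hn A hR)).trans_lt hC.lt_top).ne
  have hfW : IsFiniteMeasure ((μHE[m] : Measure F).restrict W) := by
    subst hm
    rw [isFiniteMeasure_restrict, InnerProductSpace.euclideanHausdorffMeasure_eq_volume]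
    exact hWb.measure_lt_top.ne
  have hmap := h.map_restrict_normalBoundary_prod hn hm hA hS hSA hW
  have := lintegral_prod_comp_fst ((μHE[n] : Measure E).restrict S)
    ((μHE[m] : Measure F).restrict W) g
  rw [Measure.restrict_apply_univ, ← hmap,
    h.homeomorph.measurableEmbedding.lintegral_map] at this
  exact this

end IsOrthogonalSplitting

/-! ### The recursion down to dimension one, and finiteness -/

section

variable {E : Type u} [NormedAddCommGroup E] [InnerProductSpace ℝ E]

theorem finrank_orthogonal_span_of_norm_eq_one [FiniteDimensional ℝ E] {k : ℕ}
    (hE : Module.finrank ℝ E = k + 1) {w : E} (hw : ‖w‖ = 1) :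
    Module.finrank ℝ (Submodule.span ℝ {w})ᗮ = k := by
  have : Fact (Module.finrank ℝ E = k + 1) := ⟨hE⟩
  exact Submodule.finrank_orthogonal_span_singleton (norm_ne_zero_iff.1 (by rw [hw]; simp))

theorem IsOuterUnitNormal.inner_pos {B : Set E} {x u : E} (h : IsOuterUnitNormal B x u)
    (h0 : (0 : E) ∈ interior B) : 0 < inner ℝ u x := by
  have h1 := h.2 0 (interior_subset h0)
  rw [inner_zero_right] at h1
  refine lt_of_le_of_ne h1 fun heq => ?_
  have hu := eq_zero_of_forall_inner_le h0 fun y hy => by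
    rw [inner_zero_right, heq]
    exact h.2 y hy
  have := h.1
  rw [hu, norm_zero] at this
  exact zero_ne_one this

/-- Every unit vector is an outer unit normal at some boundary point. -/
theorem IsConvexBody₀.exists_mem_frontier_isOuterUnitNormal [FiniteDimensional ℝ E] {B : Set E}
    (hB : IsConvexBody₀ B) {u : E} (hu : ‖u‖ = 1) : ∃ x ∈ frontier B, IsOuterUnitNormal B x u := by
  obtain ⟨x, hx, hmax⟩ := hB.isBounded.isCompact_closure.exists_isMaxOn
    (f := fun y => inner ℝ u y) ⟨0, interior_subset_closure hB.zero_mem_interior⟩ (by fun_prop)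
  have hle : ∀ y ∈ B, inner ℝ u y ≤ inner ℝ u x := fun y hy => hmax (subset_closure hy)
  refine ⟨x, ⟨hx, fun hint => ?_⟩, hu, hle⟩
  rw [eq_zero_of_forall_inner_le hint hle, norm_zero] at hu
  exact zero_ne_one hu

variable [MeasurableSpace E] [BorelSpace E]

/-- The unit vectors are `e` and `-e`, each normal at exactly one boundary point; the two points lie
on opposite sides of the origin. -/
theorem IsConvexBody₀.measure_essentialBoundary_of_finrank_eq_one [FiniteDimensional ℝ E]
    {B : Set E} (hB : IsConvexBody₀ B) (hE : Module.finrank ℝ E = 1) :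
    (μHE[0] : Measure E) (essentialBoundary B) = 2 := by
  have : Nontrivial E := Module.nontrivial_of_finrank_pos (R := ℝ) (by rw [hE]; exact one_pos)
  obtain ⟨e, he⟩ := exists_norm_eq E zero_le_one
  have he0 : e ≠ 0 := norm_ne_zero_iff.1 (by rw [he]; simp)
  have hspan : ∀ x : E, ∃ t : ℝ, t • e = x := (finrank_eq_one_iff_of_nonzero' e he0).1 hE
  have hunit : ∀ u : E, ‖u‖ = 1 → u = e ∨ u = -e := by
    intro u hu
    obtain ⟨t, rfl⟩ := hspan u
    rw [norm_smul, he, mul_one, Real.norm_eq_abs] at hu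
    rcases eq_or_eq_neg_of_abs_eq hu with rfl | rfl <;> simp
  have hinj : ∀ x y : E, inner ℝ e x = inner ℝ e y → x = y := by
    intro x y hxy
    obtain ⟨t, rfl⟩ := hspan x
    obtain ⟨s, rfl⟩ := hspan y
    rw [real_inner_smul_right, real_inner_smul_right, real_inner_self_eq_norm_sq, he, one_pow,
      mul_one, mul_one] at hxy
    rw [hxy]
  obtain ⟨a, ha, hae⟩ := hB.exists_mem_frontier_isOuterUnitNormal he
  obtain ⟨b, hb, hbe⟩ := hB.exists_mem_frontier_isOuterUnitNormal (u := -e) (by rwa [norm_neg])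
  have hapos := hae.inner_pos hB.zero_mem_interior
  have hbpos := hbe.inner_pos hB.zero_mem_interior
  rw [inner_neg_left] at hbpos
  have hess : essentialBoundary B = {a} ∪ {b} := by
    ext x
    constructor
    · rintro ⟨hx, u, hu, -⟩
      have h1 := fun y hy => hu.inner_le_of_mem_closure (y := y) (frontier_subset_closure hy)
      rcases hunit u hu.1 with rfl | rfl
      · left
        exact hinj _ _ (le_antisymm
          (hae.inner_le_of_mem_closure (frontier_subset_closure hx)) (h1 a ha))
      · right
        have h2 := hbe.inner_le_of_mem_closure (frontier_subset_closure hx)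
        have h3 := h1 b hb
        rw [inner_neg_left, inner_neg_left] at h2 h3
        exact hinj _ _ (by linarith)
    · rintro (rfl | rfl)
      · refine ⟨ha, e, hae, fun u hu => ?_⟩
        rcases hunit u hu.1 with rfl | rfl
        · rfl
        · have := hu.inner_pos hB.zero_mem_interior
          rw [inner_neg_left] at this
          linarith
      · refine ⟨hb, -e, hbe, fun u hu => ?_⟩
        rcases hunit u hu.1 with rfl | rfl
        · have := hu.inner_pos hB.zero_mem_interior
          linarith
        · rfl
  have hab : a ≠ b := by
    rintro rfl
    linarith
  rw [hess, measure_union (disjoint_singleton.2 hab) (measurableSet_singleton b),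
    Measure.euclideanHausdorffMeasure_zero, Measure.hausdorffMeasure_zero_singleton,
    Measure.hausdorffMeasure_zero_singleton, one_add_one_eq_two]

/-- The integrand in the recursive definition of the self-volume. -/
noncomputable def selfVolumeDensity (k : ℕ) (B : Set E) (x : E) : ℝ≥0∞ :=
  selfVolume k (centralSection B (outerUnitNormal B x)) /
    (μHE[k] : Measure _) (centralSection B (outerUnitNormal B x))

/-- The recursion for the self-volume holds in dimension one as well. -/
theorem IsConvexBody₀.selfVolume_succ [FiniteDimensional ℝ E] {B : Set E}
    (hB : IsConvexBody₀ B) {k : ℕ} (hE : Module.finrank ℝ E = k + 1) :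
    selfVolume (k + 1) B =
      ((k + 1 : ℕ) : ℝ≥0∞)⁻¹ * ∫⁻ x in essentialBoundary B, selfVolumeDensity k B x ∂μHE[k] := by
  cases k with
  | succ k => rfl
  | zero =>
    -- Sections are the single point of a zero-dimensional space, so the convention `ω^(0) = 1`
    -- makes the density 1.
    have hd : EqOn (selfVolumeDensity 0 B) (fun _ => 1) (essentialBoundary B) := by
      intro x hx
      have hfin := finrank_orthogonal_span_of_norm_eq_one hE (outerUnitNormal_spec hx).1
      have hsub : Subsingleton (Submodule.span ℝ {outerUnitNormal B x})ᗮ :=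
        Module.finrank_zero_iff.1 hfin
      have hsec : _root_.centralSection B (outerUnitNormal B x) = {0} :=
        (Set.subsingleton_of_subsingleton.eq_singleton_of_mem
          (interior_subset (hB.centralSection _).zero_mem_interior))
      rw [selfVolumeDensity, hsec, Measure.euclideanHausdorffMeasure_zero,
        Measure.hausdorffMeasure_zero_singleton, div_one]
      rfl
    rw [setLIntegral_congr_fun (measurableSet_essentialBoundary hB.isBounded) hd, setLIntegral_one,
      hB.measure_essentialBoundary_of_finrank_eq_one hE]
    simp [selfVolume]

end

/-- The self-volume is bounded in terms of the dimension, the inradius and the circumradius. -/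
theorem exists_selfVolume_bound (k : ℕ) {r : ℝ} (hr : 0 < r) (R : ℝ) :
    ∃ C : ℝ≥0∞, C ≠ ∞ ∧ ∀ (E : Type u) [NormedAddCommGroup E] [InnerProductSpace ℝ E]
      [FiniteDimensional ℝ E] [MeasurableSpace E] [BorelSpace E], Module.finrank ℝ E = k →
      ∀ A : Set E, Metric.ball 0 r ⊆ A → (∀ x ∈ A, ‖x‖ ≤ R) → selfVolume k A ≤ C := by
  induction k using Nat.twoStepInduction with
  | zero => exact ⟨1, by simp, fun E _ _ _ _ _ _ A _ _ => by simp [selfVolume]⟩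
  | one => exact ⟨2, by simp, fun E _ _ _ _ _ _ A _ _ => by simp [selfVolume]⟩
  | more k _ ih =>
    -- Central sections inherit the same `r` and `R`, so `C` bounds all their self-volumes, `c`
    -- bounds their volumes below, and `D` bounds the boundary area.
    obtain ⟨C, hC, hsec⟩ := ih
    obtain ⟨D, hD, hbd⟩ := exists_normalBoundary_measure_bound.{u} (k + 1) R
    set c := volume (Metric.ball (0 : EuclideanSpace ℝ (Fin (k + 1))) r) with hc
    have hc0 : c ≠ 0 := (Metric.measure_ball_pos _ _ hr).ne'
    refine ⟨((k + 2 : ℕ) : ℝ≥0∞)⁻¹ * (C / c * D), ENNReal.mul_ne_top (by simp)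
      (ENNReal.mul_ne_top (ENNReal.div_ne_top hC hc0) hD), ?_⟩
    intro E _ _ _ _ _ hE A hrA hAR
    have hA : Bornology.IsBounded A := isBounded_iff_forall_norm_le.2 ⟨R, hAR⟩
    rw [selfVolume]
    gcongr
    calc _ ≤ ∫⁻ _ in essentialBoundary A, C / c ∂μHE[k + 1] := by
          refine setLIntegral_mono' (measurableSet_essentialBoundary hA) fun x hx => ?_
          have hfin := finrank_orthogonal_span_of_norm_eq_one hE (outerUnitNormal_spec hx).1
          have hball : Metric.ball 0 r ⊆ centralSection A (outerUnitNormal A x) := fun y hy =>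
            hrA (by simpa using hy)
          refine ENNReal.div_le_div (hsec _ hfin _ hball fun y hy => hAR _ hy) ?_
          rw [hc, ← euclideanHausdorffMeasure_ball hfin]
          exact measure_mono hball
      _ = C / c * (μHE[k + 1] : Measure E) (essentialBoundary A) := setLIntegral_const _ _
      _ ≤ C / c * D := by
          gcongr
          exact (measure_mono (essentialBoundary_subset_normalBoundary A)).trans (hbd E hE A hAR)

namespace IsConvexBody₀

variable {E : Type u} [NormedAddCommGroup E] [InnerProductSpace ℝ E] [FiniteDimensional ℝ E]
  [MeasurableSpace E] [BorelSpace E] {A : Set E}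

theorem selfVolume_ne_top (hA : IsConvexBody₀ A) {k : ℕ} (hE : Module.finrank ℝ E = k) :
    selfVolume k A ≠ ∞ := by
  obtain ⟨r, hr, hrA⟩ := Metric.mem_nhds_iff.1 (mem_interior_iff_mem_nhds.1 hA.zero_mem_interior)
  obtain ⟨R, hR⟩ := hA.isBounded.exists_norm_le
  obtain ⟨C, hC, h⟩ := exists_selfVolume_bound.{u} k hr R
  exact ((h E hE A hrA hR).trans_lt hC.lt_top).ne

theorem measure_ne_top (hA : IsConvexBody₀ A) {k : ℕ} (hE : Module.finrank ℝ E = k) :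
    (μHE[k] : Measure E) A ≠ ∞ := by
  subst hE
  rw [InnerProductSpace.euclideanHausdorffMeasure_eq_volume]
  exact hA.isBounded.measure_lt_top.ne

theorem measure_interior (hA : IsConvexBody₀ A) {k : ℕ} (hE : Module.finrank ℝ E = k) :
    (μHE[k] : Measure E) (interior A) = (μHE[k] : Measure E) A := by
  subst hE
  exact measure_interior_of_null_frontier (hA.convex.addHaar_frontier _)

theorem measure_ne_zero (hA : IsConvexBody₀ A) {k : ℕ} (hE : Module.finrank ℝ E = k) :
    (μHE[k] : Measure E) A ≠ 0 := by
  rw [← hA.measure_interior hE]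
  subst hE
  exact (isOpen_interior.measure_pos _ hA.nonempty_interior).ne'

theorem lintegral_selfVolumeDensity (hA : IsConvexBody₀ A) {k : ℕ}
    (hE : Module.finrank ℝ E = k + 1) :
    ∫⁻ x in essentialBoundary A, selfVolumeDensity k A x ∂μHE[k] =
      ((k + 1 : ℕ) : ℝ≥0∞) * selfVolume (k + 1) A := by
  rw [hA.selfVolume_succ hE, ← mul_assoc,
    ENNReal.mul_inv_cancel (by simp) (ENNReal.natCast_ne_top _), one_mul]

end IsConvexBody₀

/-- The product formula for the self-volume in dimensions `n` and `m`. -/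
def SelfVolumeProdFormula (n m : ℕ) : Prop :=
  ∀ (V E F : Type u) [NormedAddCommGroup V] [InnerProductSpace ℝ V]
    [NormedAddCommGroup E] [InnerProductSpace ℝ E] [NormedAddCommGroup F] [InnerProductSpace ℝ F]
    [MeasurableSpace V] [BorelSpace V] [MeasurableSpace E] [BorelSpace E]
    [MeasurableSpace F] [BorelSpace F]
    [FiniteDimensional ℝ V] [FiniteDimensional ℝ E] [FiniteDimensional ℝ F]
    (p : V →L[ℝ] E) (q : V →L[ℝ] F), IsOrthogonalSplitting p q →
    Module.finrank ℝ E = n → Module.finrank ℝ F = m →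
    ∀ (A : Set E) (B : Set F), IsConvexBody₀ A → IsConvexBody₀ B →
      selfVolume (n + m) (p ⁻¹' A ∩ q ⁻¹' B) = selfVolume n A * selfVolume m B

/-! ### The product formula -/

section Product

variable {V E F : Type u} [NormedAddCommGroup V] [InnerProductSpace ℝ V]
  [NormedAddCommGroup E] [InnerProductSpace ℝ E] [NormedAddCommGroup F] [InnerProductSpace ℝ F]
  [MeasurableSpace V] [BorelSpace V] [MeasurableSpace E] [BorelSpace E]
  [MeasurableSpace F] [BorelSpace F]
  [FiniteDimensional ℝ V] [FiniteDimensional ℝ E] [FiniteDimensional ℝ F]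
  {p : V →L[ℝ] E} {q : V →L[ℝ] F} {A : Set E} {B : Set F}

/-- The normal at `v` lies in the first summand, so the section is a section of `A` times all of
`B`; the numerator factors by induction and the denominator as a volume. -/
theorem IsOrthogonalSplitting.selfVolumeDensity_prod (h : IsOrthogonalSplitting p q) {n m : ℕ}
    (hn : Module.finrank ℝ E = n + 1) (hm : Module.finrank ℝ F = m)
    (hA : IsConvexBody₀ A) (hB : IsConvexBody₀ B) (ih : SelfVolumeProdFormula.{u} n m) {v : V}
    (hv : v ∈ essentialBoundary (p ⁻¹' A ∩ q ⁻¹' B)) (hq : q v ∈ interior B) :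
    selfVolumeDensity (n + m) (p ⁻¹' A ∩ q ⁻¹' B) v =
      selfVolumeDensity n A (p v) * (selfVolume m B / (μHE[m] : Measure F) B) := by
  obtain ⟨hqw, hpw⟩ := h.map_outerUnitNormal hq hv
  have hpv := (h.mem_essentialBoundary_iff hq).1 hv
  have hfin := finrank_orthogonal_span_of_norm_eq_one hn (outerUnitNormal_spec hpv).1
  obtain ⟨p', q', h', hp', hq'⟩ := h.exists_orthogonal hqw hpw
  have hsec : centralSection (p ⁻¹' A ∩ q ⁻¹' B) (outerUnitNormal (p ⁻¹' A ∩ q ⁻¹' B) v) =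
      p' ⁻¹' centralSection A (outerUnitNormal A (p v)) ∩ q' ⁻¹' B := by
    ext y
    simp only [centralSection, mem_inter_iff, mem_preimage, mem_ofPred_eq, hp', hq']
  rw [selfVolumeDensity, selfVolumeDensity, hsec,
    ih _ _ _ p' q' h' hfin hm _ _ (hA.centralSection _) hB,
    h'.euclideanHausdorffMeasure_prod hfin hm,
    ENNReal.mul_div_mul_comm (Or.inr (hB.measure_ne_top hm)) (Or.inr (hB.measure_ne_zero hm))]

/-- This is one half of the boundary integral. The integrand does not depend on the `B` component,
so integrating it out cancels `|B|`. The separate `k` allows use with both `h` and `h.symm`. -/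
theorem IsOrthogonalSplitting.lintegral_selfVolumeDensity_prod (h : IsOrthogonalSplitting p q)
    {n m k : ℕ} (hk : n + m = k + 1) (hn : Module.finrank ℝ E = n) (hm : Module.finrank ℝ F = m)
    (hA : IsConvexBody₀ A) (hB : IsConvexBody₀ B)
    (ih : ∀ n', n = n' + 1 → SelfVolumeProdFormula.{u} n' m) :
    ∫⁻ v in essentialBoundary (p ⁻¹' A ∩ q ⁻¹' B) ∩ q ⁻¹' interior B,
        selfVolumeDensity k (p ⁻¹' A ∩ q ⁻¹' B) v ∂μHE[k] =
      n * (selfVolume n A * selfVolume m B) := by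
  have hset : essentialBoundary (p ⁻¹' A ∩ q ⁻¹' B) ∩ q ⁻¹' interior B =
      p ⁻¹' essentialBoundary A ∩ q ⁻¹' interior B := by
    ext v
    exact and_congr_left fun hv => h.mem_essentialBoundary_iff hv
  cases n with
  | zero =>
    -- For `n = 0` the body `A` is the whole space and has empty frontier; both sides vanish.
    have hsub : Subsingleton E := Module.finrank_zero_iff.1 hn
    have hAu : A = univ := eq_univ_of_forall fun x => by
      rw [Subsingleton.elim x 0]
      exact interior_subset hA.zero_mem_interior
    have hess : essentialBoundary A = ∅ := by
      refine eq_empty_of_forall_notMem fun x hx => ?_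
      have := hx.1
      rw [hAu, frontier_univ] at this
      exact this
    rw [hset, hess]
    simp
  | succ n =>
    obtain rfl : k = n + m := by omega
    have hc : selfVolume m B / (μHE[m] : Measure F) B ≠ ∞ :=
      ENNReal.div_ne_top (hB.selfVolume_ne_top hm) (hB.measure_ne_zero hm)
    have hmeas : MeasurableSet (p ⁻¹' essentialBoundary A ∩ q ⁻¹' interior B) :=
      (p.continuous.measurable (measurableSet_essentialBoundary hA.isBounded)).inter
        (q.continuous.measurable isOpen_interior.measurableSet)
    rw [hset, setLIntegral_congr_fun (g := fun v => selfVolumeDensity n A (p v) *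
        (selfVolume m B / (μHE[m] : Measure F) B)) hmeas fun v hv =>
          h.selfVolumeDensity_prod hn hm hA hB (ih n rfl)
            ((h.mem_essentialBoundary_iff hv.2).2 hv.1) hv.2,
      h.setLIntegral_normalBoundary_prod hn hm hA.isBounded
        (measurableSet_essentialBoundary hA.isBounded)
        (essentialBoundary_subset_normalBoundary A) isOpen_interior.measurableSet
        (hB.isBounded.subset interior_subset)
        fun x => selfVolumeDensity n A x * (selfVolume m B / (μHE[m] : Measure F) B),
      lintegral_mul_const' _ _ hc, hA.lintegral_selfVolumeDensity hn, hB.measure_interior hm,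
      mul_assoc, ENNReal.div_mul_cancel (hB.measure_ne_zero hm) (hB.measure_ne_top hm), mul_assoc]

end Product

theorem selfVolumeProdFormula (n m : ℕ) : SelfVolumeProdFormula.{u} n m := by
  induction hN : n + m generalizing n m with
  | zero =>
    obtain ⟨rfl, rfl⟩ := Nat.add_eq_zero_iff.1 hN
    intro V E F _ _ _ _ _ _ _ _ _ _ _ _ _ _ _ p q h hn hm A B hA hB
    simp [selfVolume]
  | succ k ih =>
    intro V E F _ _ _ _ _ _ _ _ _ _ _ _ _ _ _ p q h hn hm A B hA hB
    have hV : Module.finrank ℝ V = k + 1 := by rw [h.finrank_eq, hn, hm, hN]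
    have h1 := h.lintegral_selfVolumeDensity_prod hN hn hm hA hB
      fun n' hn' => ih n' m (by omega)
    have h2 := h.symm.lintegral_selfVolumeDensity_prod (k := k) (by omega) hm hn hB hA
      fun m' hm' => ih m' n (by omega)
    -- The second half becomes the complement of the first within the same essential boundary, so
    -- the two integrals add up.
    rw [← h.essentialBoundary_sdiff hA hB, inter_comm (q ⁻¹' B)] at h2
    rw [hN, (hA.prod hB h).selfVolume_succ hV,
      ← lintegral_inter_add_sdiff _ _ (q.continuous.measurable isOpen_interior.measurableSet),
      h1, h2, mul_comm (selfVolume m B), ← add_mul, ← Nat.cast_add, hN, ← mul_assoc,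
      ENNReal.inv_mul_cancel (by simp) (ENNReal.natCast_ne_top _), one_mul]

theorem theorem4p3 (n m : ℕ) (hn : 1 ≤ n) (hm : 1 ≤ m)
    (A : Set (EuclideanSpace ℝ (Fin n))) (B : Set (EuclideanSpace ℝ (Fin m)))
    (hA : Convex ℝ A) (hA_bdd : Bornology.IsBounded A) (hA_zero : (0 : EuclideanSpace ℝ (Fin n)) ∈ interior A)
    (hB : Convex ℝ B) (hB_bdd : Bornology.IsBounded B) (hB_zero : (0 : EuclideanSpace ℝ (Fin m)) ∈ interior B) :
    selfVolume n A ≠ ∞ ∧ selfVolume m B ≠ ∞ ∧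
      selfVolume (n + m) (euclideanProd A B) = selfVolume n A * selfVolume m B := by
  have hA' : IsConvexBody₀ A := ⟨hA, hA_bdd, hA_zero⟩
  have hB' : IsConvexBody₀ B := ⟨hB, hB_bdd, hB_zero⟩
  refine ⟨hA'.selfVolume_ne_top finrank_euclideanSpace_fin,
    hB'.selfVolume_ne_top finrank_euclideanSpace_fin, ?_⟩
  let p : EuclideanSpace ℝ (Fin (n + m)) →L[ℝ] EuclideanSpace ℝ (Fin n) :=
    LinearMap.toContinuousLinearMap
      { toFun := fun z => WithLp.toLp 2 fun i => z (Fin.castAdd m i)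
        map_add' := fun _ _ => rfl
        map_smul' := fun _ _ => rfl }
  let q : EuclideanSpace ℝ (Fin (n + m)) →L[ℝ] EuclideanSpace ℝ (Fin m) :=
    LinearMap.toContinuousLinearMap
      { toFun := fun z => WithLp.toLp 2 fun j => z (Fin.natAdd n j)
        map_add' := fun _ _ => rfl
        map_smul' := fun _ _ => rfl }
  have h : IsOrthogonalSplitting p q := by
    refine ⟨fun v => ?_, fun a b => ⟨WithLp.toLp 2 (Fin.append a b), ?_, ?_⟩⟩
    · rw [EuclideanSpace.norm_sq_eq, EuclideanSpace.norm_sq_eq, EuclideanSpace.norm_sq_eq,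
        Fin.sum_univ_add]
      rfl
    · ext i
      exact Fin.append_left _ _ i
    · ext i
      exact Fin.append_right _ _ i
  exact selfVolumeProdFormula n m _ _ _ p q h finrank_euclideanSpace_fin
    finrank_euclideanSpace_fin A B hA' hB'
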